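/- Theorem 9.1. Let $p_{2k}=\frac{k(2k+1)}{2}$ and $p_{2k-1}=\frac{(4k-1)^2}{16}$ for $k\ge 1$. Then for every complex $x$ with $\Re x\ge 0$ the continued fraction $$K(x):=\mathop{\mathrm{K}}_{k=1}^{\infty}\left(\frac{p_k}{x+\frac14}\right)=\cfrac{p_1}{x+\frac14+\cfrac{p_2}{x+\frac14+\cdots}}$$ converges to a finite value (the limit of its approximants), and $x+\frac14+K(x)\neq 0$, so that $$CF(x):=\frac12+\frac{1/4}{x+\frac14+K(x)}$$ is well defined. Moreover $$L:=\sum_{m=0}^{\infty}\frac{(-1)^m((2m)!)^2}{16^m(m!)^4}=\frac{\Gamma(1/4)}{2\sqrt{\pi}\,\Gamma(3/4)}$$ (the series being the limit of its partial sums), and for every integer $n\ge 0$, $$L=\sum_{m=0}^{n-1}\frac{((2m)!)^2}{(-16)^m(m!)^4}+\frac{((2n)!)^2}{(-16)^n(n!)^4}\cdot CF(n).$$ -/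

import Mathlib

open Filter Topology

noncomputable section

/-- The continued fraction `b 0 + K_{n ≥ 1} (a n / b n)` (the value `a 0` is not used). -/
def contFrac (a b : ℕ → ℂ) : GenContFract ℂ :=
  ⟨b 0, Stream'.Seq.ofStream (fun n : ℕ => ⟨a (n + 1), b (n + 1)⟩)⟩

/-- The continued fraction `g` converges to the finite value `τ`: all but finitely many of its
denominators `B n` are nonzero, and the approximants `A n / B n` tend to `τ`. -/
def CFConvergesTo (g : GenContFract ℂ) (τ : ℂ) : Prop :=
  (∀ᶠ n : ℕ in atTop, g.dens.get n ≠ 0) ∧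
    Tendsto (fun n : ℕ => g.convs.get n) atTop (𝓝 τ)

/-- The value of a continued fraction, the limit of its approximants `A n / B n`
(meaningful only when the continued fraction converges). -/
def cfValue (g : GenContFract ℂ) : ℂ :=
  limUnder atTop (fun n : ℕ => g.convs.get n)

/-- The sequence with `p (2 * k) = k * (2 * k + 1) / 2` and
`p (2 * k - 1) = (4 * k - 1) ^ 2 / 16` for `k ≥ 1` (the value `p 0` is not used). -/
def landauP (i : ℕ) : ℂ :=
  if Even i then ((i / 2 : ℕ) : ℂ) * (2 * ((i / 2 : ℕ) : ℂ) + 1) / 2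
  else (4 * (((i + 1) / 2 : ℕ) : ℂ) - 1) ^ 2 / 16

/-- The continued fraction `K_{k ≥ 1} (p k / (x + 1/4))`, with zero head term. -/
def landauK (x : ℂ) : GenContFract ℂ :=
  contFrac landauP (fun k => if k = 0 then 0 else x + 1 / 4)

/-- `CF(x) = 1/2 + (1/4) / (x + 1/4 + K_{k ≥ 1} (p k / (x + 1/4)))`. -/
def landauCF (x : ℂ) : ℂ :=
  1 / 2 + (1 / 4) / (x + 1 / 4 + cfValue (landauK x))

/-- `L = Γ(1/4) / (2 √π Γ(3/4))`. -/
def landauL : ℝ :=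
  Real.Gamma (1 / 4) / (2 * Real.sqrt Real.pi * Real.Gamma (3 / 4))

end

/-! Write `A n`, `B n` for the canonical numerators and denominators at `y = x + 1/4`. Positive `p
k` with `Re y > 0` keep every tail in the right half plane, so all approximants from index `N + 1`
on lie within `1 / weylInvRadius p y N` of approximant `N + 1`. Since `p k ≤ k ^ 2`, the inverse
radii grow at least like the harmonic series, which gives convergence (`exists_tendsto_cf`). The
limit has nonnegative real part, so the outer denominator has real part at least `1/4`.

The remainder formula rests on a contiguity relation: `contig` maps solutions of the recurrence at
`y` to solutions at `y + 1`, and in the limit it links the two values by a Möbius map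
(`contig_limit`). At `y = n + 1/4` this reads `CF(n) = 1 - ((2n+1)/(2n+2))² CF(n+1)`. Iteration
gives partial sum plus remainder equal to `CF(0)` for every `n`; the terms vanish and `CF` is
bounded, so the series sums to `CF(0)`.

Independently, the binomial series and Wallis integrals turn the series into `π⁻¹ ∫ (1 + sin²
θ)^(-1/2)` over `[0, π]`, a Beta value (`integral_inv_sqrt`), which identifies `CF(0)` with
`landauL`. -/

/-! ### Three-term recurrences and their tails -/

/-- The canonical denominators of `K_{k ≥ 1} (p k / y)`. -/
def cfDen {R : Type*} [CommRing R] (p : ℕ → R) (y : R) : ℕ → R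
  | 0 => 1
  | 1 => y
  | n + 2 => y * cfDen p y (n + 1) + p (n + 2) * cfDen p y n

/-- The canonical numerators of `K_{k ≥ 1} (p k / y)`. -/
def cfNum {R : Type*} [CommRing R] (p : ℕ → R) (y : R) : ℕ → R
  | 0 => 0
  | 1 => p 1
  | n + 2 => y * cfNum p y (n + 1) + p (n + 2) * cfNum p y n

/-- Any solution of the three-term recurrence, at a later index, is a fixed combination of its
values at two consecutive earlier indices, with a tail in the half plane `y.re ≤ t.re`. -/
theorem exists_tail {p : ℕ → ℝ} {y : ℂ} (hp : ∀ n, 0 < p (n + 1)) (hy : 0 < y.re) (j N : ℕ) :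
    ∃ t c : ℂ, y.re ≤ t.re ∧ c ≠ 0 ∧ ∀ u : ℕ → ℂ,
      (∀ n, u (n + 2) = y * u (n + 1) + p (n + 2) * u n) →
        u (N + 2 + j) = c * (t * u (N + 1) + p (N + 2) * u N) := by
  induction j generalizing N with
  | zero => exact ⟨y, 1, le_rfl, one_ne_zero, fun u hu => by simpa using hu N⟩
  | succ j ih =>
    obtain ⟨t, c, ht, hc, h⟩ := ih (N + 1)
    have ht0 : t ≠ 0 := by
      rintro rfl
      simp at ht
      linarith
    -- Substituting the recurrence for `u (N + 2)` prepends one level to the tail; `p / t` has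
    -- nonnegative real part because `t` does.
    refine ⟨y + p (N + 3) / t, c * t, ?_, mul_ne_zero hc ht0, fun u hu => ?_⟩
    · have : 0 ≤ ((p (N + 3) : ℂ) / t).re := by
        rw [Complex.div_re]
        have h1 := (hp (N + 2)).le
        have h2 : 0 ≤ t.re := hy.le.trans ht
        have h3 := Complex.normSq_nonneg t
        simp only [Complex.ofReal_re, Complex.ofReal_im, zero_mul, zero_div, add_zero]
        positivity
      rw [Complex.add_re]
      linarith
    · have h1 := h u hu
      rw [show N + 2 + (j + 1) = N + 1 + 2 + j by ring, h1, hu N]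
      field_simp
      ring

/-! ### Convergence in the right half plane by Weyl discs -/

section Convergence

variable {p : ℕ → ℝ} {y : ℂ}

/-- The partial products `p 1 * ⋯ * p n`. -/
noncomputable def prodTo (p : ℕ → ℝ) (n : ℕ) : ℝ := ∏ k ∈ Finset.range n, p (k + 1)

theorem prodTo_succ (p : ℕ → ℝ) (n : ℕ) : prodTo p (n + 1) = prodTo p n * p (n + 1) :=
  Finset.prod_range_succ _ _

theorem prodTo_pos (hp : ∀ n, 0 < p (n + 1)) (n : ℕ) : 0 < prodTo p n :=
  Finset.prod_pos fun k _ => hp k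

/-- The inverse radius of the Weyl disc containing all later approximants. -/
noncomputable def weylInvRadius (p : ℕ → ℝ) (y : ℂ) (n : ℕ) : ℝ :=
  (cfDen (fun k => (p k : ℂ)) y (n + 1) *
    (starRingEnd ℂ) (cfDen (fun k => (p k : ℂ)) y n)).re / prodTo p (n + 1)

/-- Multiply the recurrence for `B (n + 2)` by the conjugate of `B (n + 1)`. The cross term has the
real part of `B (n + 1) * conj (B n)`, and its factor `p (n + 2)` cancels against `prodTo p (n +
2)`. -/
theorem weylInvRadius_succ (hp : ∀ n, 0 < p (n + 1)) (n : ℕ) :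
    weylInvRadius p y (n + 1) = weylInvRadius p y n +
      y.re * Complex.normSq (cfDen (fun k => (p k : ℂ)) y (n + 1)) / prodTo p (n + 2) := by
  have h1 := (prodTo_pos hp (n + 1)).ne'
  have h2 := (hp (n + 1)).ne'
  simp only [weylInvRadius, cfDen, prodTo_succ p (n + 1)]
  rw [prodTo_succ] at *
  field_simp
  simp only [Complex.mul_re, Complex.add_re, Complex.mul_im, Complex.add_im, Complex.conj_re,
    Complex.conj_im, Complex.ofReal_re, Complex.ofReal_im, Complex.normSq_apply]
  ring

theorem weylInvRadius_zero : weylInvRadius p y 0 = y.re / p 1 := by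
  simp [weylInvRadius, cfDen, prodTo]

theorem weylInvRadius_mono (hp : ∀ n, 0 < p (n + 1)) (hy : 0 < y.re) :
    Monotone (weylInvRadius p y) := by
  refine monotone_nat_of_le_succ fun n => ?_
  rw [weylInvRadius_succ hp]
  have := prodTo_pos hp (n + 2)
  have := Complex.normSq_nonneg (cfDen (fun k => (p k : ℂ)) y (n + 1))
  have : 0 ≤ y.re * Complex.normSq (cfDen (fun k => (p k : ℂ)) y (n + 1)) / prodTo p (n + 2) := by
    positivity
  linarith

theorem weylInvRadius_pos (hp : ∀ n, 0 < p (n + 1)) (hy : 0 < y.re) (n : ℕ) :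
    0 < weylInvRadius p y n :=
  lt_of_lt_of_le (by rw [weylInvRadius_zero]; exact div_pos hy (hp 0))
    (weylInvRadius_mono hp hy (Nat.zero_le n))

theorem cfDen_ne_zero (hp : ∀ n, 0 < p (n + 1)) (hy : 0 < y.re) (n : ℕ) :
    cfDen (fun k => (p k : ℂ)) y n ≠ 0 := by
  intro h
  have := weylInvRadius_pos hp hy n
  simp [weylInvRadius, h] at this

/-- Two consecutive increments of the inverse radius are bounded below. -/
theorem weylInvRadius_add_two (hp : ∀ n, 0 < p (n + 1)) (hp' : ∀ n, p (n + 1) ≤ (n + 1 : ℝ) ^ 2)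
    (hy : 0 < y.re) (n : ℕ) :
    weylInvRadius p y n + 2 * y.re * (y.re / p 1) / (n + 3) ≤ weylInvRadius p y (n + 2) := by
  set B := cfDen (fun k => (p k : ℂ)) y with hB
  have hs := prodTo_pos hp
  rw [weylInvRadius_succ hp (n + 1), weylInvRadius_succ hp n]
  have hD : y.re / p 1 ≤ ‖B (n + 2)‖ * ‖B (n + 1)‖ / prodTo p (n + 2) := by
    calc y.re / p 1 = weylInvRadius p y 0 := weylInvRadius_zero.symm
      _ ≤ weylInvRadius p y (n + 1) := weylInvRadius_mono hp hy (Nat.zero_le _)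
      _ ≤ _ := by
        unfold weylInvRadius
        refine div_le_div_of_nonneg_right ?_ (hs _).le
        refine (Complex.re_le_norm _).trans ?_
        rw [norm_mul, RCLike.norm_conj]
  rw [Complex.normSq_eq_norm_sq, Complex.normSq_eq_norm_sq]
  set a := ‖B (n + 1)‖
  set b := ‖B (n + 2)‖
  set P := prodTo p (n + 2)
  have hP : 0 < P := hs _
  have hq := hp (n + 2)
  have hq' := hp' (n + 2)
  rw [show prodTo p (n + 1 + 2) = P * p (n + 3) from prodTo_succ p (n + 2)]
  set q := p (n + 3)
  push_cast at hq'
  have hn : (0 : ℝ) < n + 3 := by positivity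
  -- AM-GM for the two increments. The bound `p (n + 3) ≤ (n + 3) ^ 2` then leaves a lower bound of
  -- harmonic size.
  have key : 2 * (b * a / P) / (n + 3) ≤ a ^ 2 / P + b ^ 2 / (P * ((n + 3) ^ 2)) := by
    have : a ^ 2 / P + b ^ 2 / (P * ((n + 3) ^ 2)) - 2 * (b * a / P) / (n + 3)
        = (a - b / (n + 3)) ^ 2 / P := by
      field_simp
      ring
    have h2 : 0 ≤ (a - b / (n + 3)) ^ 2 / P := by positivity
    linarith
  have h3 : b ^ 2 / (P * ((n + 3) ^ 2)) ≤ b ^ 2 / (P * q) := by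
    gcongr
    linarith
  have h4 : 2 * (y.re / p 1) / (n + 3) ≤ 2 * (b * a / P) / (n + 3) := by gcongr
  have h5 : y.re * (2 * (y.re / p 1) / (n + 3)) ≤ y.re * (a ^ 2 / P + b ^ 2 / (P * q)) :=
    mul_le_mul_of_nonneg_left (by linarith) hy.le
  calc weylInvRadius p y n + 2 * y.re * (y.re / p 1) / (n + 3)
      = weylInvRadius p y n + y.re * (2 * (y.re / p 1) / (n + 3)) := by ring
    _ ≤ weylInvRadius p y n + y.re * (a ^ 2 / P + b ^ 2 / (P * q)) := by linarith
    _ = _ := by ring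

theorem tendsto_weylInvRadius (hp : ∀ n, 0 < p (n + 1))
    (hp' : ∀ n, p (n + 1) ≤ (n + 1 : ℝ) ^ 2) (hy : 0 < y.re) :
    Tendsto (weylInvRadius p y) atTop atTop := by
  set c := y.re * (y.re / p 1)
  have hc : 0 < c := mul_pos hy (div_pos hy (hp 0))
  -- The offset `5/2` exceeds the harmonic sums `3/2` and `11/6` at `n = 0, 1`, so both base cases
  -- follow from positivity.
  have hharm : Tendsto (fun n : ℕ => c * ∑ k ∈ Finset.range (n + 2), 1 / ((k : ℝ) + 1) - 5 / 2 * c)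
      atTop atTop :=
    tendsto_atTop_add_const_right _ _
      ((Real.tendsto_sum_range_one_div_nat_succ_atTop.comp
        (tendsto_add_atTop_nat 2)).const_mul_atTop hc)
  refine tendsto_atTop_mono (fun n => ?_) hharm
  have h0 := fun n => (weylInvRadius_pos hp hy n).le
  induction n using Nat.twoStepInduction with
  | zero =>
    norm_num [Finset.sum_range_succ]
    linarith [h0 0]
  | one =>
    norm_num [Finset.sum_range_succ]
    linarith [h0 1]
  | more n ih _ =>
    refine le_trans ?_ (weylInvRadius_add_two hp hp' hy n)
    rw [Finset.sum_range_succ, Finset.sum_range_succ, mul_assoc 2]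
    have h1 : 2 * c / ((n : ℝ) + 3) = c * (1 / (n + 3)) + c * (1 / (n + 3)) := by ring
    have h2 : c * (1 / ((n : ℝ) + 4)) ≤ c * (1 / (n + 3)) := by gcongr; norm_num
    rw [h1]
    push_cast
    rw [show (n : ℝ) + 2 + 1 = n + 3 by ring, show (n : ℝ) + 3 + 1 = n + 4 by ring]
    linarith

theorem det_cf (p : ℕ → ℝ) (y : ℂ) (n : ℕ) :
    cfNum (fun k => (p k : ℂ)) y (n + 1) * cfDen (fun k => (p k : ℂ)) y n -
      cfNum (fun k => (p k : ℂ)) y n * cfDen (fun k => (p k : ℂ)) y (n + 1) =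
        (-1) ^ n * prodTo p (n + 1) := by
  induction n with
  | zero => simp [cfNum, cfDen, prodTo]
  | succ n ih =>
    rw [prodTo_succ, Complex.ofReal_mul, pow_succ,
      show (-1 : ℂ) ^ n * -1 * (prodTo p (n + 1) * p (n + 1 + 1)) =
        -(p (n + 1 + 1) : ℂ) * ((-1) ^ n * prodTo p (n + 1)) by ring, ← ih]
    simp only [cfNum, cfDen]
    ring

/-- By `exists_tail` the later approximant is a Möbius image of the tail `t`, and `det_cf` evaluates
the difference. In the denominator, `Re (conj B1 * (t * B1 + q * B0))` is at least `q * Re (B1 *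
conj B0)`, since `t` has nonnegative real part. -/
theorem norm_convs_sub_le (hp : ∀ n, 0 < p (n + 1)) (hy : 0 < y.re) (N j : ℕ) :
    ‖cfNum (fun k => (p k : ℂ)) y (N + 2 + j) / cfDen (fun k => (p k : ℂ)) y (N + 2 + j) -
      cfNum (fun k => (p k : ℂ)) y (N + 1) / cfDen (fun k => (p k : ℂ)) y (N + 1)‖ ≤
        1 / weylInvRadius p y N := by
  obtain ⟨t, c, ht, hc, h⟩ := exists_tail hp hy j N
  have hA := h (cfNum (fun k => (p k : ℂ)) y) (fun n => rfl)
  have hB := h (cfDen (fun k => (p k : ℂ)) y) (fun n => rfl)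
  have hB0 := cfDen_ne_zero hp hy (N + 2 + j)
  have hB1 := cfDen_ne_zero hp hy (N + 1)
  have hdet := det_cf p y N
  have hw := weylInvRadius_pos hp hy N
  have hP := prodTo_pos hp (N + 1)
  unfold weylInvRadius at hw ⊢
  rw [hB] at hB0
  rw [hA, hB]
  have hq := hp (N + 1)
  set A1 := cfNum (fun k => (p k : ℂ)) y (N + 1)
  set A0 := cfNum (fun k => (p k : ℂ)) y N
  set B1 := cfDen (fun k => (p k : ℂ)) y (N + 1)
  set B0 := cfDen (fun k => (p k : ℂ)) y N
  set q := p (N + 2)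
  set P := prodTo p (N + 1)
  have hE : t * B1 + q * B0 ≠ 0 := right_ne_zero_of_mul hB0
  have hre : 0 < (B1 * (starRingEnd ℂ) B0).re := by
    have := mul_pos hw hP
    rwa [div_mul_cancel₀ _ hP.ne'] at this
  have heq : c * (t * A1 + q * A0) / (c * (t * B1 + q * B0)) - A1 / B1 =
      -(q * ((-1) ^ N * P)) / (B1 * (t * B1 + q * B0)) := by
    rw [← hdet, mul_div_mul_left _ _ hc]
    field_simp
    ring
  rw [heq, norm_div, norm_neg, norm_mul, norm_mul, norm_pow, norm_neg, norm_one, one_pow, one_mul,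
    Complex.norm_real, Complex.norm_real, Real.norm_of_nonneg hq.le, Real.norm_of_nonneg hP.le,
    one_div_div]
  have hlow : q * (B1 * (starRingEnd ℂ) B0).re ≤ ‖B1 * (t * B1 + q * B0)‖ := by
    have h1 : q * (B1 * (starRingEnd ℂ) B0).re ≤ ((starRingEnd ℂ) B1 * (t * B1 + q * B0)).re := by
      have : ((starRingEnd ℂ) B1 * (t * B1 + q * B0)).re =
          t.re * Complex.normSq B1 + q * (B1 * (starRingEnd ℂ) B0).re := by
        simp only [Complex.mul_re, Complex.add_re, Complex.mul_im, Complex.add_im,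
          Complex.conj_re, Complex.conj_im, Complex.ofReal_re, Complex.ofReal_im,
          Complex.normSq_apply]
        ring
      rw [this]
      have := mul_nonneg (hy.le.trans ht) (Complex.normSq_nonneg B1)
      linarith
    refine h1.trans ((Complex.re_le_norm _).trans ?_)
    rw [norm_mul, norm_mul, RCLike.norm_conj]
  calc q * P / ‖B1 * (t * B1 + q * B0)‖ ≤ q * P / (q * (B1 * (starRingEnd ℂ) B0).re) := by
        gcongr
    _ = P / (B1 * (starRingEnd ℂ) B0).re := by
        field_simp

/-- Convergence of `K (p k / y)` for positive `p k ≤ k ^ 2` and `y` in the right half plane. -/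
theorem exists_tendsto_cf (hp : ∀ n, 0 < p (n + 1)) (hp' : ∀ n, p (n + 1) ≤ (n + 1 : ℝ) ^ 2)
    (hy : 0 < y.re) :
    ∃ τ : ℂ, 0 ≤ τ.re ∧ Tendsto (fun n => cfNum (fun k => (p k : ℂ)) y n /
      cfDen (fun k => (p k : ℂ)) y n) atTop (𝓝 τ) := by
  set f := fun n => cfNum (fun k => (p k : ℂ)) y n / cfDen (fun k => (p k : ℂ)) y n with hf
  have hcau : CauchySeq f := by
    rw [Metric.cauchySeq_iff']
    intro ε hε
    have ht := (tendsto_weylInvRadius hp hp' hy).eventually_gt_atTop (1 / ε)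
    obtain ⟨N, hN⟩ := ht.exists
    refine ⟨N + 1, fun n hn => ?_⟩
    rcases Nat.eq_or_lt_of_le hn with rfl | h
    · simpa using hε
    · obtain ⟨j, rfl⟩ := Nat.exists_eq_add_of_le (Nat.succ_le_of_lt h)
      rw [dist_eq_norm]
      refine (norm_convs_sub_le hp hy N j).trans_lt ?_
      rw [div_lt_comm₀ (weylInvRadius_pos hp hy N) hε]
      exact hN
  obtain ⟨τ, hτ⟩ := cauchySeq_tendsto_of_complete hcau
  refine ⟨τ, ?_, hτ⟩
  have hre : Tendsto (fun n => (f (0 + 2 + n)).re) atTop (𝓝 τ.re) := by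
    have := (Complex.continuous_re.tendsto τ).comp (hτ.comp (tendsto_add_atTop_nat 2))
    refine this.congr fun n => ?_
    simp [add_comm]
  -- From index 2 on, an approximant is `t * p 1 / (t * y + p 2)` with `t` in the half plane, hence
  -- has nonnegative real part.
  refine ge_of_tendsto' hre fun j => ?_
  obtain ⟨t, c, ht, hc, h⟩ := exists_tail hp hy j 0
  have hA := h (cfNum (fun k => (p k : ℂ)) y) (fun n => rfl)
  have hB := h (cfDen (fun k => (p k : ℂ)) y) (fun n => rfl)
  simp only [hf, hA, hB]
  rw [mul_div_mul_left _ _ hc]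
  simp only [cfNum, cfDen, zero_add, mul_zero, add_zero, mul_one]
  have h1 := hp 0
  have h2 := hp 1
  rw [zero_add] at h1
  have : 0 ≤ (t * p 1 * (starRingEnd ℂ) (t * y + p 2)).re := by
    have : (t * p 1 * (starRingEnd ℂ) (t * y + p 2)).re =
        p 1 * (Complex.normSq t * y.re + t.re * p 2) := by
      simp only [Complex.mul_re, Complex.add_re, Complex.mul_im, Complex.add_im,
          Complex.conj_re, Complex.conj_im, Complex.ofReal_re, Complex.ofReal_im,
          Complex.normSq_apply]
      ring
    rw [this]
    have := Complex.normSq_nonneg t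
    have : 0 ≤ t.re := hy.le.trans ht
    have : 0 < p 2 := h2
    positivity
  rw [div_eq_mul_inv, Complex.inv_def, ← mul_assoc, Complex.re_mul_ofReal]
  exact mul_nonneg this (inv_nonneg.2 (Complex.normSq_nonneg _))

end Convergence

/-! ### The coefficients `landauP` and the value of `landauK` -/

/-- `landauP` as a real sequence. -/
noncomputable def landauPReal (i : ℕ) : ℝ :=
  if Even i then ((i / 2 : ℕ) : ℝ) * (2 * ((i / 2 : ℕ) : ℝ) + 1) / 2
  else (4 * (((i + 1) / 2 : ℕ) : ℝ) - 1) ^ 2 / 16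

theorem landauP_eq_ofReal : landauP = fun k => (landauPReal k : ℂ) := by
  funext k
  unfold landauP landauPReal
  split_ifs <;> push_cast <;> rfl

theorem landauPReal_even (j : ℕ) : landauPReal (2 * j) = j * (2 * j + 1) / 2 := by
  simp [landauPReal]

theorem landauPReal_odd (j : ℕ) : landauPReal (2 * j + 1) = (4 * j + 3) ^ 2 / 16 := by
  have h : ¬ Even (2 * j + 1) := by simp
  rw [landauPReal, if_neg h, show (2 * j + 1 + 1) / 2 = j + 1 by omega]
  push_cast
  ring

theorem landauPReal_pos (n : ℕ) : 0 < landauPReal (n + 1) := by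
  obtain ⟨j, rfl | rfl⟩ := Nat.even_or_odd' n
  · rw [landauPReal_odd]
    positivity
  · rw [show 2 * j + 1 + 1 = 2 * (j + 1) by ring, landauPReal_even]
    positivity

theorem landauPReal_le (n : ℕ) : landauPReal (n + 1) ≤ (n + 1 : ℝ) ^ 2 := by
  obtain ⟨j, rfl | rfl⟩ := Nat.even_or_odd' n
  · rw [landauPReal_odd]
    have : (0 : ℝ) ≤ j := j.cast_nonneg
    push_cast
    nlinarith
  · rw [show 2 * j + 1 + 1 = 2 * (j + 1) by ring, landauPReal_even]
    have : (0 : ℝ) ≤ j := j.cast_nonneg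
    push_cast
    nlinarith

/-- The shift is due to `contsAux 0` being the formal pair `⟨1, 0⟩` of index `-1`. -/
theorem landauK_contsAux (x : ℂ) (n : ℕ) :
    (landauK x).contsAux (n + 1) =
      ⟨cfNum landauP (x + 1 / 4) n, cfDen landauP (x + 1 / 4) n⟩ := by
  have hget (k : ℕ) : (landauK x).s.get? k = some ⟨landauP (k + 1), x + 1 / 4⟩ := by
    simp [landauK, contFrac, Stream'.Seq.get?, Stream'.Seq.ofStream, Stream'.map, Stream'.get]
  induction n using Nat.twoStepInduction with
  | zero => simp [GenContFract.contsAux, landauK, contFrac, cfNum, cfDen]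
  | one =>
    rw [GenContFract.contsAux_recurrence (hget 0) rfl rfl]
    simp [GenContFract.contsAux, landauK, contFrac, cfNum, cfDen]
  | more n ih1 ih2 =>
    rw [GenContFract.contsAux_recurrence (hget (n + 1)) ih1 ih2]
    rfl

theorem landauK_dens (x : ℂ) (n : ℕ) :
    (landauK x).dens.get n = cfDen landauP (x + 1 / 4) n :=
  congrArg GenContFract.Pair.b (landauK_contsAux x n)

theorem landauK_convs (x : ℂ) (n : ℕ) :
    (landauK x).convs.get n = cfNum landauP (x + 1 / 4) n / cfDen landauP (x + 1 / 4) n :=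
  congrArg₂ (· / ·) (congrArg GenContFract.Pair.a (landauK_contsAux x n)) (landauK_dens x n)

theorem landauK_converges {x : ℂ} (hx : 0 ≤ x.re) :
    CFConvergesTo (landauK x) (cfValue (landauK x)) ∧ 0 ≤ (cfValue (landauK x)).re := by
  have hy : 0 < (x + 1 / 4).re := by
    rw [Complex.add_re]
    norm_num
    linarith
  obtain ⟨τ, hτ, h⟩ := exists_tendsto_cf landauPReal_pos landauPReal_le hy
  rw [← landauP_eq_ofReal] at h
  have h' : Tendsto (fun n => (landauK x).convs.get n) atTop (𝓝 τ) := by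
    simpa only [landauK_convs] using h
  have hv : cfValue (landauK x) = τ := h'.limUnder_eq
  rw [hv]
  refine ⟨⟨Eventually.of_forall fun n => ?_, h'⟩, hτ⟩
  rw [landauK_dens, landauP_eq_ofReal]
  exact cfDen_ne_zero landauPReal_pos hy n

theorem landauK_add_ne_zero {x : ℂ} (hx : 0 ≤ x.re) : x + 1 / 4 + cfValue (landauK x) ≠ 0 := by
  intro h
  have h1 := congrArg Complex.re h
  have h2 := (landauK_converges hx).2
  norm_num at h1
  linarith

/-! ### Real arguments -/

section Real

theorem cfDen_ofReal (p : ℕ → ℝ) (y : ℝ) (n : ℕ) :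
    cfDen (fun k => (p k : ℂ)) y n = ((cfDen p y n : ℝ) : ℂ) := by
  induction n using Nat.twoStepInduction with
  | zero => simp [cfDen]
  | one => simp [cfDen]
  | more n ih1 ih2 => simp [cfDen, ih1, ih2]

theorem cfNum_ofReal (p : ℕ → ℝ) (y : ℝ) (n : ℕ) :
    cfNum (fun k => (p k : ℂ)) y n = ((cfNum p y n : ℝ) : ℂ) := by
  induction n using Nat.twoStepInduction with
  | zero => simp [cfNum]
  | one => simp [cfNum]
  | more n ih1 ih2 => simp [cfNum, ih1, ih2]

theorem cfDen_pos {p : ℕ → ℝ} (hp : ∀ n, 0 < p (n + 1)) {y : ℝ} (hy : 0 < y) (n : ℕ) :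
    0 < cfDen p y n := by
  induction n using Nat.twoStepInduction with
  | zero => simp [cfDen]
  | one => simpa [cfDen]
  | more n ih1 ih2 =>
    have := hp (n + 1)
    simp only [cfDen]
    positivity

/-- At real `x` the value of the continued fraction is a nonnegative real. -/
theorem exists_landauK_real {x : ℝ} (hx : 0 ≤ x) :
    ∃ κ : ℝ, 0 ≤ κ ∧ cfValue (landauK x) = κ ∧
      Tendsto (fun n => cfNum landauPReal (x + 1 / 4) n / cfDen landauPReal (x + 1 / 4) n)
        atTop (𝓝 κ) := by
  have hx' : 0 ≤ (x : ℂ).re := by simpa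
  obtain ⟨⟨-, h⟩, h0⟩ := landauK_converges hx'
  have hre (n : ℕ) : (landauK x).convs.get n =
      ((cfNum landauPReal (x + 1 / 4) n / cfDen landauPReal (x + 1 / 4) n : ℝ) : ℂ) := by
    rw [landauK_convs, landauP_eq_ofReal, Complex.ofReal_div, ← cfNum_ofReal, ← cfDen_ofReal]
    push_cast
    rfl
  simp only [hre] at h
  have h1 : Tendsto (fun n => cfNum landauPReal (x + 1 / 4) n / cfDen landauPReal (x + 1 / 4) n)
      atTop (𝓝 (cfValue (landauK x)).re) :=
    (Complex.continuous_re.tendsto _).comp h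
  refine ⟨_, h0, ?_, h1⟩
  exact tendsto_nhds_unique h ((Complex.continuous_ofReal.tendsto _).comp h1)

end Real

/-! ### Contiguity between `y` and `y + 1` -/

section Contiguity

/-- The coefficient of `u n` in the contiguity relation expressing the solutions at `y + 1` through
those at `y`. -/
noncomputable def contigCoeff (y : ℝ) (k : ℕ) : ℝ :=
  4 * y ^ 2 + (4 * k + 6) * y + if Even k then (2 * k + 9 / 4 : ℝ) else 2 * k + 7 / 4

theorem contigCoeff_even (y : ℝ) (j : ℕ) :
    contigCoeff y (2 * j) = 4 * y ^ 2 + (8 * j + 6) * y + (4 * j + 9 / 4) := by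
  simp [contigCoeff]
  ring

theorem contigCoeff_odd (y : ℝ) (j : ℕ) :
    contigCoeff y (2 * j + 1) = 4 * y ^ 2 + (8 * j + 10) * y + (4 * j + 15 / 4) := by
  have h : ¬ Even (2 * j + 1) := by simp
  rw [contigCoeff, if_neg h]
  push_cast
  ring

theorem contigCoeff_pos {y : ℝ} (hy : 0 < y) (k : ℕ) : 0 < contigCoeff y k := by
  unfold contigCoeff
  split_ifs <;> positivity

/-- The contiguity operator sending solutions of the recurrence at `y` to solutions at `y + 1`. -/
noncomputable def contig (y : ℝ) (u : ℕ → ℝ) (n : ℕ) : ℝ :=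
  contigCoeff y (n + 2) * u (n + 1) + 4 * (2 * y + 1) * landauPReal (n + 2) * u n

/-- After `u (n + 2)` and `u (n + 3)` are eliminated, the coefficients of `u (n + 1)` and `u n`
agree as polynomials in `y` and `j`, separately for each parity of `n`. -/
theorem contig_rec (y : ℝ) {u : ℕ → ℝ}
    (hu : ∀ n, u (n + 2) = y * u (n + 1) + landauPReal (n + 2) * u n) (n : ℕ) :
    contig y u (n + 2) =
      (y + 1) * contig y u (n + 1) + landauPReal (n + 3) * contig y u n := by
  have h3 := hu (n + 1)
  rw [show n + 1 + 2 = n + 3 by ring, show n + 1 + 1 = n + 2 by ring] at h3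
  simp only [contig, show n + 2 + 2 = n + 4 by ring, show n + 2 + 1 = n + 3 by ring,
    show n + 1 + 1 = n + 2 by ring, h3, hu n]
  obtain ⟨j, rfl | rfl⟩ := Nat.even_or_odd' n
  · rw [show 2 * j + 4 = 2 * (j + 2) by ring, show 2 * j + 3 = 2 * (j + 1) + 1 by ring,
      show 2 * j + 2 = 2 * (j + 1) by ring]
    simp only [contigCoeff_even, contigCoeff_odd, landauPReal_even, landauPReal_odd]
    push_cast
    ring
  · rw [show 2 * j + 1 + 4 = 2 * (j + 2) + 1 by ring, show 2 * j + 1 + 3 = 2 * (j + 2) by ring,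
      show 2 * j + 1 + 2 = 2 * (j + 1) + 1 by ring]
    simp only [contigCoeff_even, contigCoeff_odd, landauPReal_even, landauPReal_odd]
    push_cast
    ring

theorem eq_of_rec {v w : ℕ → ℝ} {a : ℝ} {q : ℕ → ℝ} (hv : ∀ n, v (n + 2) = a * v (n + 1) + q n * v n)
    (hw : ∀ n, w (n + 2) = a * w (n + 1) + q n * w n) (h0 : v 0 = w 0) (h1 : v 1 = w 1) (n : ℕ) :
    v n = w n := by
  induction n using Nat.twoStepInduction with
  | zero => exact h0
  | one => exact h1
  | more n ih1 ih2 => rw [hv, hw, ih1, ih2]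

theorem landauPReal_one : landauPReal 1 = 9 / 16 := by
  have := landauPReal_odd 0
  norm_num at this
  exact this

theorem landauPReal_two : landauPReal 2 = 3 / 2 := by
  have := landauPReal_even 1
  norm_num at this
  exact this

theorem landauPReal_three : landauPReal 3 = 49 / 16 := by
  have := landauPReal_odd 1
  norm_num at this
  exact this

theorem contigCoeff_two (y : ℝ) : contigCoeff y 2 = 4 * y ^ 2 + 14 * y + 25 / 4 := by
  have := contigCoeff_even y 1
  norm_num at this
  rw [this]

theorem contigCoeff_three (y : ℝ) : contigCoeff y 3 = 4 * y ^ 2 + 18 * y + 31 / 4 := by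
  have := contigCoeff_odd y 1
  norm_num at this
  rw [this]

/-- Both sides solve the recurrence at `y + 1` with coefficient `p (n + 3)`, whence the index `n +
1` on the right; two initial values decide. -/
theorem contig_cfDen (y : ℝ) (n : ℕ) :
    contig y (cfDen landauPReal y) n =
      4 * (2 * y + 1) * ((y + 1) * cfDen landauPReal (y + 1) (n + 1) +
        cfNum landauPReal (y + 1) (n + 1)) -
      (2 * y + 1 / 2) ^ 2 * cfDen landauPReal (y + 1) (n + 1) := by
  refine eq_of_rec (contig_rec y fun n => rfl)
    (w := fun n => 4 * (2 * y + 1) * ((y + 1) * cfDen landauPReal (y + 1) (n + 1) +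
        cfNum landauPReal (y + 1) (n + 1)) -
      (2 * y + 1 / 2) ^ 2 * cfDen landauPReal (y + 1) (n + 1)) (fun n => ?_) ?_ ?_ n
  · simp only [cfDen, cfNum]
    ring
  · simp only [contig, cfDen, cfNum, contigCoeff_two, landauPReal_one, landauPReal_two, zero_add]
    ring
  · simp only [contig, cfDen, cfNum, contigCoeff_three, landauPReal_one, landauPReal_two,
      landauPReal_three, zero_add, Nat.reduceAdd]
    ring

theorem contig_cfNum (y : ℝ) (n : ℕ) :
    contig y (fun k => y * cfDen landauPReal y k + cfNum landauPReal y k) n =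
      (2 * y + 3 / 2) ^ 2 * ((y + 1) * cfDen landauPReal (y + 1) (n + 1) +
        cfNum landauPReal (y + 1) (n + 1)) := by
  refine eq_of_rec (contig_rec y fun n => ?_)
    (w := fun n => (2 * y + 3 / 2) ^ 2 * ((y + 1) * cfDen landauPReal (y + 1) (n + 1) +
        cfNum landauPReal (y + 1) (n + 1))) (fun n => ?_) ?_ ?_ n
  · simp only [cfDen, cfNum]
    ring
  · simp only [cfDen, cfNum]
    ring
  · simp only [contig, cfDen, cfNum, contigCoeff_two, landauPReal_one, landauPReal_two, zero_add]
    ring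
  · simp only [contig, cfDen, cfNum, contigCoeff_three, landauPReal_one, landauPReal_two,
      landauPReal_three, zero_add, Nat.reduceAdd]
    ring

/-- A mean with positive weights inherits the limit of `r` and `s` however the weights vary; in
`contig_limit`, `r` and `s` are consecutive approximants. -/
theorem abs_mediant_sub_le {α β r s G : ℝ} (hα : 0 < α) (hβ : 0 < β) :
    |(α * r + β * s) / (α + β) - G| ≤ |r - G| + |s - G| := by
  have h : (α * r + β * s) / (α + β) - G = (α * (r - G) + β * (s - G)) / (α + β) := by
    field_simp
    ring
  rw [h, abs_div, abs_of_pos (add_pos hα hβ), div_le_iff₀ (add_pos hα hβ)]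
  refine (abs_add_le _ _).trans ?_
  rw [abs_mul, abs_mul, abs_of_pos hα, abs_of_pos hβ]
  have := mul_nonneg hα.le (abs_nonneg (s - G))
  have := mul_nonneg hβ.le (abs_nonneg (r - G))
  nlinarith

/-- The Bauer–Muir type relation between the values at `y` and `y + 1`. -/
theorem contig_limit {y κ κ' : ℝ} (hy : 0 < y) (hκ' : 0 ≤ κ')
    (h : Tendsto (fun n => cfNum landauPReal y n / cfDen landauPReal y n) atTop (𝓝 κ))
    (h' : Tendsto (fun n => cfNum landauPReal (y + 1) n / cfDen landauPReal (y + 1) n)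
      atTop (𝓝 κ')) :
    (y + κ) * (4 * (2 * y + 1) * (y + 1 + κ') - (2 * y + 1 / 2) ^ 2) =
      (2 * y + 3 / 2) ^ 2 * (y + 1 + κ') := by
  have hB := cfDen_pos landauPReal_pos hy
  have hB' := cfDen_pos landauPReal_pos (add_pos hy one_pos)
  have hden : 0 < 4 * (2 * y + 1) * (y + 1 + κ') - (2 * y + 1 / 2) ^ 2 := by
    have := mul_nonneg hy.le hκ'
    nlinarith
  -- Its limit is found twice: as a weighted mean of approximants at `y`, and through `contig_cfNum`
  -- and `contig_cfDen` as a Möbius function of those at `y + 1`.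
  set ratio := fun n => contig y (fun k => y * cfDen landauPReal y k + cfNum landauPReal y k) n /
    contig y (cfDen landauPReal y) n with hratio
  have h1 : Tendsto ratio atTop (𝓝 (y + κ)) := by
    have hr : Tendsto (fun n => |(y + cfNum landauPReal y n / cfDen landauPReal y n) - (y + κ)|)
        atTop (𝓝 0) := by
      have := ((h.const_add y).sub_const (y + κ)).abs
      simpa using this
    rw [tendsto_iff_norm_sub_tendsto_zero]
    have hsum := (hr.comp (tendsto_add_atTop_nat 1)).add hr
    rw [add_zero] at hsum
    refine squeeze_zero (fun _ => norm_nonneg _) (fun n => ?_) hsum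
    have hα := mul_pos (contigCoeff_pos hy (n + 2)) (hB (n + 1))
    have hβ : 0 < 4 * (2 * y + 1) * landauPReal (n + 2) * cfDen landauPReal y n := by
      have := landauPReal_pos (n + 1)
      have := hB n
      positivity
    refine le_trans (le_of_eq ?_) (abs_mediant_sub_le hα hβ)
    rw [Real.norm_eq_abs, hratio]
    simp only [contig]
    have e1 := (hB n).ne'
    have e2 := (hB (n + 1)).ne'
    congr 3
    field_simp
  have h2 : Tendsto ratio atTop (𝓝 ((2 * y + 3 / 2) ^ 2 * (y + 1 + κ') /
      (4 * (2 * y + 1) * (y + 1 + κ') - (2 * y + 1 / 2) ^ 2))) := by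
    have hG := (h'.const_add (y + 1)).comp (tendsto_add_atTop_nat 1)
    refine ((hG.const_mul ((2 * y + 3 / 2) ^ 2)).div
      ((hG.const_mul (4 * (2 * y + 1))).sub_const ((2 * y + 1 / 2) ^ 2)) hden.ne').congr fun n => ?_
    rw [hratio]
    have e := (hB' (n + 1)).ne'
    simp only [contig_cfDen, contig_cfNum, Function.comp, Pi.div_apply]
    rw [← mul_div_mul_right _ _ e]
    congr 1 <;> field_simp
  rw [tendsto_nhds_unique h1 h2, div_mul_cancel₀ _ hden.ne']

/-- At `y = n + 1/4` the constants of `contig_limit` become `8n + 6`, `(2n + 1)²` and `(2n + 2)²`;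
substituting `CF = 1/2 + 1/(4G)` makes the Möbius relation affine. -/
theorem landauCF_succ (n : ℕ) :
    landauCF n = 1 - ((2 * n + 1) / (2 * n + 2) : ℂ) ^ 2 * landauCF (n + 1 : ℕ) := by
  obtain ⟨κ, h0, hv, h⟩ := exists_landauK_real (x := n) n.cast_nonneg
  obtain ⟨κ', h0', hv', h'⟩ := exists_landauK_real (x := (n + 1 : ℕ)) (n + 1).cast_nonneg
  have hn : (0 : ℝ) ≤ n := n.cast_nonneg
  rw [show ((n + 1 : ℕ) : ℝ) + 1 / 4 = (n + 1 / 4) + 1 by push_cast; ring] at h'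
  have key := contig_limit (by positivity) h0' h h'
  rw [Complex.ofReal_natCast] at hv hv'
  rw [landauCF, landauCF, hv, hv']
  have e1 : (n + 1 / 4 + κ : ℝ) ≠ 0 := by positivity
  have e2 : (n + 1 + 1 / 4 + κ' : ℝ) ≠ 0 := by positivity
  have e3 : (2 * n + 2 : ℝ) ≠ 0 := by positivity
  have goal : (1 / 2 + 1 / 4 / (n + 1 / 4 + κ) : ℝ) =
      1 - ((2 * n + 1) / (2 * n + 2)) ^ 2 * (1 / 2 + 1 / 4 / (n + 1 + 1 / 4 + κ')) := by
    generalize hG : (n + 1 / 4 + κ : ℝ) = G at key e1 ⊢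
    generalize hG' : (n + 1 + 1 / 4 + κ' : ℝ) = G' at e2 ⊢
    rw [show (n + 1 / 4 + 1 + κ' : ℝ) = G' by rw [← hG']; ring] at key
    have e : (1 / 2 + 1 / 4 / G : ℝ) - (1 - ((2 * n + 1) / (2 * n + 2)) ^ 2 *
        (1 / 2 + 1 / 4 / G')) = ((2 * n + 2) ^ 2 * G' - G * ((8 * n + 6) * G' - (2 * n + 1) ^ 2)) /
          (4 * G * (2 * n + 2) ^ 2 * G') := by
      field_simp
      ring
    rw [← sub_eq_zero, e, div_eq_zero_iff]
    left
    linear_combination -key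
  have := congrArg (Complex.ofReal) goal
  push_cast at this ⊢
  exact this

theorem norm_landauCF_le {x : ℂ} (hx : 0 ≤ x.re) : ‖landauCF x‖ ≤ 3 / 2 := by
  have h2 := (landauK_converges hx).2
  have h3 : 1 / 4 ≤ ‖x + 1 / 4 + cfValue (landauK x)‖ := by
    refine le_trans ?_ (Complex.re_le_norm _)
    norm_num
    linarith
  unfold landauCF
  refine (norm_add_le _ _).trans ?_
  rw [norm_div]
  have : ‖(1 / 4 : ℂ)‖ / ‖x + 1 / 4 + cfValue (landauK x)‖ ≤ 1 := by
    rw [div_le_one (by linarith)]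
    norm_num at h3 ⊢
    exact h3
  norm_num at this ⊢
  linarith

end Contiguity

/-! ### The sum of the series as a Beta integral -/

section Series

/-- `C(2n, n) / 4 ^ n` as a Wallis product. -/
noncomputable def wallisCoeff (n : ℕ) : ℝ :=
  ∏ i ∈ Finset.range n, (2 * (i : ℝ) + 1) / (2 * i + 2)

theorem wallisCoeff_succ (n : ℕ) :
    wallisCoeff (n + 1) = wallisCoeff n * ((2 * (n : ℝ) + 1) / (2 * n + 2)) :=
  Finset.prod_range_succ _ _

theorem wallisCoeff_pos (n : ℕ) : 0 < wallisCoeff n :=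
  Finset.prod_pos fun i _ => by positivity

theorem wallisCoeff_antitone : Antitone wallisCoeff := by
  refine antitone_nat_of_succ_le fun n => ?_
  rw [wallisCoeff_succ]
  refine mul_le_of_le_one_right (wallisCoeff_pos n).le ?_
  rw [div_le_one (by positivity)]
  linarith

theorem wallisCoeff_eq (n : ℕ) :
    wallisCoeff n = ((2 * n).factorial : ℝ) / (4 ^ n * (n.factorial : ℝ) ^ 2) := by
  induction n with
  | zero => simp [wallisCoeff]
  | succ n ih =>
    rw [wallisCoeff_succ, ih, show 2 * (n + 1) = 2 * n + 1 + 1 by ring, Nat.factorial_succ,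
      Nat.factorial_succ, Nat.factorial_succ]
    have := n.factorial_ne_zero
    push_cast
    field_simp
    ring

theorem wallisCoeff_sq (n : ℕ) : wallisCoeff n ^ 2 =
    ((2 * n).factorial : ℝ) ^ 2 / (16 ^ n * (n.factorial : ℝ) ^ 4) := by
  rw [wallisCoeff_eq, div_pow, mul_pow, ← pow_mul, ← pow_mul, mul_comm n 2, pow_mul]
  norm_num

theorem choose_neg_half (n : ℕ) : Ring.choose (-(1 / 2) : ℝ) n = (-1) ^ n * wallisCoeff n := by
  rw [Ring.choose_eq_smul]
  induction n with
  | zero => simp [wallisCoeff]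
  | succ n ih =>
    have hf : (n.factorial : ℝ) ≠ 0 := by exact_mod_cast n.factorial_ne_zero
    rw [smul_eq_mul, inv_mul_eq_iff_eq_mul₀ hf] at ih
    rw [descPochhammer_succ_right, Polynomial.smeval_mul, ih, wallisCoeff_succ, Nat.factorial_succ]
    simp only [Polynomial.smeval_sub, Polynomial.smeval_X, Polynomial.smeval_natCast, pow_one,
      pow_zero, smul_eq_mul, nsmul_eq_mul, mul_one]
    push_cast
    field_simp
    ring

theorem hasSum_inv_sqrt {z : ℝ} (hz : |z| < 1) :
    HasSum (fun n => (-1) ^ n * wallisCoeff n * z ^ n) ((1 + z) ^ (-(1 / 2) : ℝ)) := by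
  have hz' : z ∈ Metric.eball (0 : ℝ) 1 := by
    simpa [Metric.mem_eball, edist_dist, Real.dist_eq] using hz
  have h := (Real.one_add_rpow_hasFPowerSeriesOnBall_zero (a := -(1 / 2))).hasSum hz'
  simp only [binomialSeries_apply, zero_add, choose_neg_half] at h
  simpa using h

/-- Peeling off the first term leaves `f 0` minus an alternating sum of the shifted sequence, which
lies in `[0, f 1]`. -/
theorem alternating_partial_sum_mem {f : ℕ → ℝ} (hf : Antitone f) (h0 : ∀ n, 0 ≤ f n) (N : ℕ) :
    ∑ m ∈ Finset.range N, (-1) ^ m * f m ∈ Set.Icc 0 (f 0) := by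
  induction N generalizing f with
  | zero => simpa using h0 0
  | succ N ih =>
    have h := ih (f := fun n => f (n + 1)) (fun a b hab => hf (by omega)) fun n => h0 _
    have e : ∑ m ∈ Finset.range (N + 1), (-1) ^ m * f m =
        f 0 - ∑ m ∈ Finset.range N, (-1) ^ m * f (m + 1) := by
      rw [Finset.sum_range_succ', sub_eq_add_neg, ← Finset.sum_neg_distrib, add_comm]
      simp [pow_succ]
    have h1 : f (0 + 1) ≤ f 0 := hf (by omega)
    rw [e]
    exact ⟨by linarith [h.2], by linarith [h.1]⟩

theorem abs_partial_sum_le {z : ℝ} (h0 : 0 ≤ z) (h1 : z ≤ 1) (N : ℕ) :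
    |∑ m ∈ Finset.range N, (-1) ^ m * wallisCoeff m * z ^ m| ≤ 1 := by
  have h := alternating_partial_sum_mem (f := fun m => wallisCoeff m * z ^ m)
    (fun a b hab => mul_le_mul (wallisCoeff_antitone hab) (pow_le_pow_of_le_one h0 h1 hab)
      (pow_nonneg h0 _) (wallisCoeff_pos a).le)
    (fun n => mul_nonneg (wallisCoeff_pos n).le (pow_nonneg h0 n)) N
  simp only [← mul_assoc] at h
  have h2 : wallisCoeff 0 * z ^ 0 = 1 := by simp [wallisCoeff]
  rw [h2] at h
  rw [abs_of_nonneg h.1]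
  exact h.2

-- `wallisCoeff m` is both the mean of `sin ^ (2 * m)` over `[0, π]` and, up to sign, a binomial
-- coefficient of `(1 + z) ^ (-1/2)`. Using it once in each role gives its square; the alternating
-- bound supplies the dominating constant `1`.
open Real MeasureTheory in
theorem tendsto_series_integral :
    Tendsto (fun N : ℕ => ∑ m ∈ Finset.range N, (-1) ^ m * wallisCoeff m ^ 2) atTop
      (𝓝 (π⁻¹ * ∫ θ in (0 : ℝ)..π, (1 + sin θ ^ 2) ^ (-(1 / 2) : ℝ))) := by
  have hint : Tendsto (fun N : ℕ => ∫ θ in (0 : ℝ)..π,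
      ∑ m ∈ Finset.range N, (-1) ^ m * wallisCoeff m * (sin θ ^ 2) ^ m) atTop
      (𝓝 (∫ θ in (0 : ℝ)..π, (1 + sin θ ^ 2) ^ (-(1 / 2) : ℝ))) := by
    refine intervalIntegral.tendsto_integral_filter_of_dominated_convergence (fun _ => 1)
      (Eventually.of_forall fun N => ?_) (Eventually.of_forall fun N => ?_) (by simp) ?_
    · exact Continuous.aestronglyMeasurable (by fun_prop)
    · exact Eventually.of_forall fun θ _ =>
        abs_partial_sum_le (sq_nonneg _) (sin_sq_le_one θ) N
    -- At `θ = π / 2` the argument `sin² θ = 1` is on the boundary of the disc of convergence.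
    · have hne : ∀ᵐ θ : ℝ, θ ≠ π / 2 := by simp [ae_iff]
      filter_upwards [hne] with θ hθ hmem
      rw [Set.uIoc_of_le pi_pos.le] at hmem
      refine (hasSum_inv_sqrt ?_).tendsto_sum_nat
      rw [abs_of_nonneg (sq_nonneg _), sin_sq]
      have hc : cos θ ≠ 0 := by
        intro hc
        rcases lt_or_gt_of_ne hθ with h | h
        · exact (cos_pos_of_mem_Ioo ⟨by linarith [hmem.1, pi_pos], h⟩).ne' hc
        · exact (cos_neg_of_pi_div_two_lt_of_lt h (by linarith [hmem.2, pi_pos])).ne hc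
      have : 0 < cos θ ^ 2 := by positivity
      linarith
  refine (hint.const_mul π⁻¹).congr fun N => ?_
  rw [intervalIntegral.integral_finsetSum fun m _ => Continuous.intervalIntegrable (by fun_prop) _ _,
    Finset.mul_sum]
  refine Finset.sum_congr rfl fun m _ => ?_
  simp only [← pow_mul]
  rw [intervalIntegral.integral_const_mul, integral_sin_pow_even]
  have := pi_ne_zero
  rw [← wallisCoeff]
  field_simp

-- Substitute `t = sin⁴ θ` in the Beta integral, with `1 - t = (1 + sin² θ) cos² θ`; the Jacobian `4
-- sin³ θ cos θ` cancels the remaining factors up to `4`.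
open Real MeasureTheory Set in
theorem integral_inv_sqrt_half :
    ∫ θ in (0 : ℝ)..π / 2, (1 + sin θ ^ 2) ^ (-(1 / 2) : ℝ) =
      (1 / 4) * ProbabilityTheory.beta (1 / 4) (1 / 2) := by
  have hbeta : ProbabilityTheory.beta (1 / 4) (1 / 2) =
      ∫ t in Ioo (0 : ℝ) 1, t ^ (-(3 / 4) : ℝ) * (1 - t) ^ (-(1 / 2) : ℝ) := by
    rw [ProbabilityTheory.beta_eq_betaIntegralReal _ _ (by norm_num) (by norm_num),
      Complex.betaIntegral, intervalIntegral.integral_of_le zero_le_one, integral_Ioc_eq_integral_Ioo,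
      ← Complex.ofReal_re (∫ t in Ioo (0 : ℝ) 1, t ^ (-(3 / 4) : ℝ) * (1 - t) ^ (-(1 / 2) : ℝ)),
      ← integral_complex_ofReal]
    congr 1
    refine setIntegral_congr_fun measurableSet_Ioo fun t ht => ?_
    have h1 : (0 : ℝ) ≤ 1 - t := by linarith [ht.2]
    rw [Complex.ofReal_mul, Complex.ofReal_cpow ht.1.le, Complex.ofReal_cpow h1]
    push_cast
    norm_num
  have hpi := pi_pos
  have hinj : StrictMonoOn (fun θ => sin θ ^ 4) (Icc 0 (π / 2)) := fun a ha b hb hab =>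
    pow_lt_pow_left₀ (sin_lt_sin_of_lt_of_le_pi_div_two (by linarith [ha.1]) hb.2 hab)
      (sin_nonneg_of_nonneg_of_le_pi ha.1 (by linarith [ha.2])) (by norm_num)
  have himage : (fun θ => sin θ ^ 4) '' Ioo 0 (π / 2) = Ioo 0 1 := by
    refine Subset.antisymm ?_ ?_
    · rintro _ ⟨θ, hθ, rfl⟩
      have h1 := hinj ⟨le_rfl, by positivity⟩ ⟨hθ.1.le, hθ.2.le⟩ hθ.1
      have h2 := hinj ⟨hθ.1.le, hθ.2.le⟩ ⟨by positivity, le_rfl⟩ hθ.2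
      simp only [sin_zero, sin_pi_div_two] at h1 h2
      exact ⟨by simpa using h1, by simpa using h2⟩
    · have := intermediate_value_Ioo (f := fun θ => sin θ ^ 4) (a := 0) (b := π / 2) (by positivity)
        (by fun_prop)
      simpa using this
  rw [hbeta, ← himage, integral_image_eq_integral_abs_deriv_smul measurableSet_Ioo
    (f' := fun θ => 4 * sin θ ^ 3 * cos θ)
    (f := fun θ => sin θ ^ 4)
    (fun θ _ => ((hasDerivAt_sin θ).pow 4).hasDerivWithinAt.congr_deriv (by norm_num))
    (hinj.injOn.mono Ioo_subset_Icc_self), intervalIntegral.integral_of_le (by positivity),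
    integral_Ioc_eq_integral_Ioo, ← integral_const_mul]
  refine setIntegral_congr_fun measurableSet_Ioo fun θ hθ => ?_
  have hs : 0 < sin θ := sin_pos_of_pos_of_lt_pi hθ.1 (by linarith [hθ.2])
  have hc : 0 < cos θ := cos_pos_of_mem_Ioo ⟨by linarith [hθ.1], hθ.2⟩
  have h1 : (sin θ ^ 4) ^ (-(3 / 4) : ℝ) = (sin θ ^ 3)⁻¹ := by
    rw [← rpow_natCast, ← rpow_mul hs.le, ← rpow_natCast, ← rpow_neg hs.le]
    norm_num
  have h2 : (1 - sin θ ^ 4) ^ (-(1 / 2) : ℝ) = (1 + sin θ ^ 2) ^ (-(1 / 2) : ℝ) * (cos θ)⁻¹ := by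
    rw [show 1 - sin θ ^ 4 = (1 + sin θ ^ 2) * cos θ ^ 2 by rw [cos_sq']; ring,
      mul_rpow (by positivity) (by positivity), ← rpow_natCast (cos θ), ← rpow_mul hc.le,
      ← rpow_neg_one]
    norm_num
  simp only [smul_eq_mul]
  rw [h1, h2, abs_of_pos (by positivity)]
  field_simp

open Real MeasureTheory Set in
theorem integral_inv_sqrt :
    π⁻¹ * ∫ θ in (0 : ℝ)..π, (1 + sin θ ^ 2) ^ (-(1 / 2) : ℝ) = landauL := by
  have hcont : Continuous fun θ : ℝ => (1 + sin θ ^ 2) ^ (-(1 / 2) : ℝ) :=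
    Continuous.rpow_const (by fun_prop) fun θ => Or.inl (by positivity)
  have hsymm : ∫ θ in (π / 2)..π, (1 + sin θ ^ 2) ^ (-(1 / 2) : ℝ) =
      ∫ θ in (0 : ℝ)..π / 2, (1 + sin θ ^ 2) ^ (-(1 / 2) : ℝ) := by
    have := intervalIntegral.integral_comp_sub_left (a := 0) (b := π / 2)
      (fun θ => (1 + sin θ ^ 2) ^ (-(1 / 2) : ℝ)) π
    simp only [sin_pi_sub] at this
    rw [this]
    congr 1 <;> ring
  rw [← intervalIntegral.integral_add_adjacent_intervals (b := π / 2)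
    (hcont.intervalIntegrable _ _) (hcont.intervalIntegrable _ _), hsymm, integral_inv_sqrt_half,
    ProbabilityTheory.beta, landauL, Real.Gamma_one_half_eq, show (1 / 4 + 1 / 2 : ℝ) = 3 / 4 by norm_num]
  have h1 : Gamma (3 / 4) ≠ 0 := (Gamma_pos_of_pos (by norm_num)).ne'
  have h2 : √π ≠ 0 := (sqrt_pos.2 pi_pos).ne'
  nth_rw 1 [← mul_self_sqrt pi_pos.le]
  field_simp
  norm_num

theorem tendsto_landau_series :
    Tendsto (fun N : ℕ => ∑ m ∈ Finset.range N, (-1) ^ m * wallisCoeff m ^ 2) atTop (𝓝 landauL) :=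
  integral_inv_sqrt ▸ tendsto_series_integral

end Series

/-! ### Remainder formula and identification of `CF(0)` -/

/-- The terms of the series, `(-1) ^ m * (wallisCoeff m) ^ 2`, over `ℂ`. -/
theorem landau_term_eq (m : ℕ) :
    ((2 * m).factorial : ℂ) ^ 2 / ((-16 : ℂ) ^ m * (m.factorial : ℂ) ^ 4) =
      (((-1) ^ m * wallisCoeff m ^ 2 : ℝ) : ℂ) := by
  rw [wallisCoeff_sq, show (-16 : ℂ) = (-1) * 16 by norm_num, mul_pow]
  push_cast
  have h : ((-1 : ℂ) ^ m) ^ 2 = 1 := by rw [← pow_mul, mul_comm, pow_mul]; simp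
  have h1 : (-1 : ℂ) ^ m ≠ 0 := pow_ne_zero _ (by norm_num)
  have h2 : (m.factorial : ℂ) ≠ 0 := by exact_mod_cast m.factorial_ne_zero
  field_simp
  rw [h, mul_one]

theorem landau_partial_sum_add_remainder (n : ℕ) :
    (∑ m ∈ Finset.range n, (((-1) ^ m * wallisCoeff m ^ 2 : ℝ) : ℂ)) +
      (((-1) ^ n * wallisCoeff n ^ 2 : ℝ) : ℂ) * landauCF n = landauCF 0 := by
  induction n with
  | zero => simp [wallisCoeff]
  | succ n ih =>
    rw [← ih, landauCF_succ n, Finset.sum_range_succ, wallisCoeff_succ]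
    push_cast
    ring

theorem landauL_eq_landauCF_zero : (landauL : ℂ) = landauCF 0 := by
  have hS := (Complex.continuous_ofReal.tendsto _).comp tendsto_landau_series
  -- Terms of a convergent series, as differences of consecutive partial sums.
  have hterm : Tendsto (fun n : ℕ => (((-1) ^ n * wallisCoeff n ^ 2 : ℝ) : ℂ)) atTop (𝓝 0) := by
    have := (hS.comp (tendsto_add_atTop_nat 1)).sub hS
    rw [sub_self] at this
    refine this.congr fun n => ?_
    simp [Finset.sum_range_succ]
  have hrem : Tendsto (fun n : ℕ => (((-1) ^ n * wallisCoeff n ^ 2 : ℝ) : ℂ) * landauCF n)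
      atTop (𝓝 0) := by
    refine squeeze_zero_norm (a := fun n => ‖(((-1) ^ n * wallisCoeff n ^ 2 : ℝ) : ℂ)‖ * (3 / 2))
      (fun n => ?_) (by simpa using hterm.norm.mul_const (3 / 2))
    rw [norm_mul]
    exact mul_le_mul_of_nonneg_left (norm_landauCF_le (by simp)) (norm_nonneg _)
  have h := hS.add hrem
  rw [add_zero] at h
  refine tendsto_nhds_unique h (tendsto_const_nhds.congr fun n => ?_)
  rw [← landau_partial_sum_add_remainder n]
  simp

theorem theorem9p1 :
    -- `CF(x)` is well defined for `Re x ≥ 0`: `K` converges and the outer denominator is nonzero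
    (∀ x : ℂ, 0 ≤ x.re →
      CFConvergesTo (landauK x) (cfValue (landauK x)) ∧
        x + 1 / 4 + cfValue (landauK x) ≠ 0) ∧
    -- the series (which is not absolutely convergent) has sum `L`
    Tendsto (fun N : ℕ => ∑ m ∈ Finset.range N,
        ((-1 : ℝ) ^ m * ((2 * m).factorial : ℝ) ^ 2) / (16 ^ m * (m.factorial : ℝ) ^ 4))
      atTop (𝓝 landauL) ∧
    -- the continued fraction representation of the remainder
    ∀ n : ℕ, (landauL : ℂ) =
      (∑ m ∈ Finset.range n,
        ((2 * m).factorial : ℂ) ^ 2 / ((-16 : ℂ) ^ m * (m.factorial : ℂ) ^ 4)) +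
      ((2 * n).factorial : ℂ) ^ 2 / ((-16 : ℂ) ^ n * (n.factorial : ℂ) ^ 4) * landauCF n := by

  refine ⟨fun x hx => ⟨(landauK_converges hx).1, landauK_add_ne_zero hx⟩, ?_, fun n => ?_⟩
  · refine tendsto_landau_series.congr fun N => Finset.sum_congr rfl fun m _ => ?_
    rw [wallisCoeff_sq, mul_div_assoc]
  · simp only [landau_term_eq]
    rw [landauL_eq_landauCF_zero, landau_partial_sum_add_remainder]
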